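/- Let $n\ge 1$ be an integer and $\Lambda=\mathbb{Z}/n$. For a profinite group $\mathfrak{G}$ let $\mathfrak{G}^{(1)}=\mathfrak{G}$ and let $\mathfrak{G}^{(i+1)}=[\mathfrak{G},\mathfrak{G}^{(i)}]\cdot(\mathfrak{G}^{(i)})^n$ (the closed subgroup generated by these commutators and $n$-th powers), and put $\mathfrak{g}_i(\mathfrak{G})=\mathfrak{G}^{(i)}/\mathfrak{G}^{(i+1)}$, written additively. For $\sigma,\tau\in\mathfrak{g}_1(\mathfrak{G})$ with lifts $\tilde\sigma,\tilde\tau\in\mathfrak{G}/\mathfrak{G}^{(3)}$ let $[\sigma,\tau]=\tilde\sigma^{-1}\tilde\tau^{-1}\tilde\sigma\tilde\tau\in\mathfrak{g}_2(\mathfrak{G})$, which does not depend on the lifts. Let $H^1(\mathfrak{g}_1(\mathfrak{G}))$ be the group of continuous homomorphisms $\mathfrak{g}_1(\mathfrak{G})\to\Lambda$; for $\sigma\in\mathfrak{g}_1(\mathfrak{G})$ and $x\in H^1(\mathfrak{g}_1(\mathfrak{G}))$ write $\sigma(x)\in\Lambda$ for the value of $x$ at $\sigma$. Let $\mathcal{H}_\Lambda$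 be the (finite) Heisenberg group of upper triangular $3\times 3$ matrices $$h(a,b;c)=\begin{pmatrix}1&a&c\\0&1&b\\0&0&1\end{pmatrix},\qquad a,b,c\in\Lambda,$$ and let $e_1,e_2\in H^1(\mathfrak{g}_1(\mathcal{H}_\Lambda))$ be the homomorphisms induced by $h(a,b;c)\mapsto a$ and $h(a,b;c)\mapsto b$. Let $\mathfrak{G}$ be a profinite group such that $\mathfrak{g}_1(\mathfrak{G})$ is isomorphic, as a profinite group, to $(\mathbb{Z}/n)^I$ for some set $I$. Let $x,y\in H^1(\mathfrak{g}_1(\mathfrak{G}))$, and let $\phi:\mathfrak{G}/\mathfrak{G}^{(3)}\to\mathcal{H}_\Lambda$ be a continuous homomorphism which solves the embedding problem $$\bigl(\mathcal{H}_\Lambda\twoheadrightarrow\mathfrak{g}_1(\mathcal{H}_\Lambda)\xrightarrow{(e_1,e_2)}\Lambda^2\ ;\ \mathfrak{G}/\mathfrak{G}^{(3)}\twoheadrightarrow\mathfrak{g}_1(\mathfrak{G})\xrightarrow{(x,y)}\Lambda^2\bigr),$$ that is, the composite of $\phi$ with the first map is the second map. Let $\phi_1:\mathfrak{g}_1(\mathfrak{G})\to\mathfrak{g}_1(\mathcal{H}_\Lambda)$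 be the homomorphism induced by $\phi$. Let $(\sigma_i)_i$ and $(\tau_i)_i$ be (possibly infinite) families in $\mathfrak{g}_1(\mathfrak{G})$ such that the collection $(\sigma_i,\tau_i)_i$ converges to $0$, i.e. every open subgroup of $\mathfrak{g}_1(\mathfrak{G})$ contains all but finitely many of the $\sigma_i$ and all but finitely many of the $\tau_i$. Then both sums below converge, and the following are equivalent: 1. $\sum_i[\phi_1\sigma_i,\phi_1\tau_i]=0$ in $\mathfrak{g}_2(\mathcal{H}_\Lambda)$. 2. $\sum_i\bigl(\sigma_i(x)\,\tau_i(y)-\sigma_i(y)\,\tau_i(x)\bigr)=0$ in $\Lambda$. -/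

import Mathlib

namespace ModCentral

/-! ### The mod-`n` central descending series and its graded pieces -/

section Series

open scoped commutatorElement

variable (n : ℕ) (G : Type*) [Group G]

/-- The subgroup generated by the `n`-th powers of the elements of `S`. -/
def powers {G : Type*} [Group G] (S : Subgroup G) : Subgroup G :=
  Subgroup.closure ((fun s => s ^ n) '' (S : Set G))

theorem powers_normal {G : Type*} [Group G] (S : Subgroup G) [hS : S.Normal] :
    (powers n S).Normal := by
  constructor
  intro a ha g
  refine Subgroup.closure_induction (p := fun a _ => g * a * g⁻¹ ∈ powers n S) ?_ ?_ ?_ ?_ ha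
  · rintro _ ⟨s, hs, rfl⟩
    refine Subgroup.subset_closure ⟨g * s * g⁻¹, hS.conj_mem s hs g, ?_⟩
    simp [conj_pow]
  · simp
  · intro a b _ _ ha hb
    have := mul_mem ha hb
    simpa [mul_assoc] using this
  · intro a _ ha
    have := inv_mem ha
    simpa [mul_assoc] using this

variable [TopologicalSpace G] [IsTopologicalGroup G]

/-- The mod-`n` central descending series of a topological group, numbered from `1`:
`G^(1) = G`, and `G^(i+1) = [G, G^(i)] · (G^(i))^n`, where (as usual for topological groups) the
closed subgroup generated by the commutators and the `n`-th powers is meant.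
The value at `0` is not used. -/
def series : ℕ → Subgroup G
  | 0 => ⊤
  | 1 => ⊤
  | i + 2 => (⁅(⊤ : Subgroup G), series (i + 1)⁆ ⊔ powers n (series (i + 1))).topologicalClosure

instance series_normal : ∀ i, (series n G i).Normal
  | 0 => inferInstanceAs (⊤ : Subgroup G).Normal
  | 1 => inferInstanceAs (⊤ : Subgroup G).Normal
  | i + 2 => by
    have := series_normal (i + 1)
    have := powers_normal n (series n G (i + 1))
    exact Subgroup.is_normal_topologicalClosure _

variable {G}

theorem commutator_mem_series {i : ℕ} (a : G) {b : G} (hb : b ∈ series n G (i + 1)) :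
    ⁅a, b⁆ ∈ series n G (i + 2) :=
  Subgroup.le_topologicalClosure _
    ((le_sup_left : _ ≤ _ ⊔ powers n (series n G (i + 1)))
      (Subgroup.commutator_mem_commutator (Subgroup.mem_top a) hb))

/-- A closed subgroup containing `[G, G^(i+1)]` and the `n`-th powers contains `G^(i+2)`. -/
theorem series_le {i : ℕ} {K : Subgroup G} (hK : IsClosed (K : Set G))
    (hc : ∀ a : G, ∀ b ∈ series n G (i + 1), ⁅a, b⁆ ∈ K)
    (hp : ∀ b ∈ series n G (i + 1), b ^ n ∈ K) : series n G (i + 2) ≤ K := by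
  refine Subgroup.topologicalClosure_minimal _ (sup_le ?_ ?_) hK
  · rw [Subgroup.commutator_le]
    exact fun a _ b hb => hc a b hb
  · rw [powers, Subgroup.closure_le]
    rintro _ ⟨s, hs, rfl⟩
    exact hp s hs

theorem map_mem_series {H : Type*} [Group H] [TopologicalSpace H] [IsTopologicalGroup H]
    (f : G →ₜ* H) : ∀ (i : ℕ) {a : G}, a ∈ series n G i → f a ∈ series n H i
  | 0, _, _ => Subgroup.mem_top _
  | 1, _, _ => Subgroup.mem_top _
  | i + 2, a, ha => by
    have hcl : IsClosed (((series n H (i + 2)).comap (f : G →* H) : Subgroup G) : Set G) :=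
      IsClosed.preimage f.continuous_toFun (Subgroup.isClosed_topologicalClosure _)
    refine series_le n hcl ?_ ?_ ha
    · intro a b hb
      have := commutator_mem_series n (f a) (map_mem_series f (i + 1) hb)
      simpa [commutatorElement_def] using this
    · intro b hb
      have : (f b) ^ n ∈ series n H (i + 2) :=
        Subgroup.le_topologicalClosure _
          ((le_sup_right : _ ≤ ⁅(⊤ : Subgroup H), series n H (i + 1)⁆ ⊔ _)
            (Subgroup.subset_closure ⟨f b, map_mem_series f (i + 1) hb, rfl⟩))
      simpa using this

variable (G)

/-- `𝔤_i(G) = G^(i) / G^(i+1)`, written additively, with the quotient topology. -/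
abbrev Gr (i : ℕ) : Type _ :=
  Additive (↥(series n G i) ⧸ (series n G (i + 1)).subgroupOf (series n G i))

instance grAddCommGroup (i : ℕ) : AddCommGroup (Gr n G i) :=
  { (inferInstance : AddGroup (Gr n G i)) with
    add_comm := by
      intro a b
      obtain ⟨⟨s, hs⟩, rfl⟩ := QuotientGroup.mk_surjective a.toMul
      obtain ⟨⟨t, ht⟩, rfl⟩ := QuotientGroup.mk_surjective b.toMul
      change (QuotientGroup.mk (_ * _) : ↥(series n G i) ⧸ _) = QuotientGroup.mk (_ * _)
      rw [QuotientGroup.eq, Subgroup.mem_subgroupOf]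
      cases i with
      | zero => exact Subgroup.mem_top _
      | succ i =>
        have := commutator_mem_series n t⁻¹ (i := i) (inv_mem hs)
        simpa [commutatorElement_def, mul_assoc] using this }

variable {G}

/-- The class in `𝔤_i` of an element of `G^(i)`. -/
def Gr.mk (i : ℕ) (s : G) (hs : s ∈ series n G i) : Gr n G i :=
  Additive.ofMul (QuotientGroup.mk (⟨s, hs⟩ : ↥(series n G i)))

/-- The homomorphism `f_i : 𝔤_i(G) → 𝔤_i(H)` induced by a continuous homomorphism `f : G → H`. -/
def Gr.map {H : Type*} [Group H] [TopologicalSpace H] [IsTopologicalGroup H]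
    (f : G →ₜ* H) (i : ℕ) : Gr n G i →+ Gr n H i :=
  MonoidHom.toAdditive <| QuotientGroup.map _ _
    (((f : G →* H).comp (series n G i).subtype).codRestrict (series n H i)
      fun s => map_mem_series n f i s.2)
    (by
      rintro ⟨s, hs⟩ h
      exact map_mem_series n f (i + 1) h)

variable (G) in
/-- The projection `G → 𝔤_1(G) = G / G^(2)`. -/
def toGr1 (g : G) : Gr n G 1 := Gr.mk n 1 g (Subgroup.mem_top g)

variable (G) in
/-- The projection `G / G^(3) → 𝔤_1(G)`. -/
def quotToGr1 : G ⧸ series n G 3 → Gr n G 1 :=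
  Quotient.lift (toGr1 n G) (by
    intro a b h
    have h3 : a⁻¹ * b ∈ series n G 3 := QuotientGroup.leftRel_apply.1 h
    have h2 : series n G 3 ≤ series n G 2 := by
      refine series_le n (Subgroup.isClosed_topologicalClosure _) ?_ ?_
      · intro a b _
        exact commutator_mem_series (i := 0) n a (Subgroup.mem_top b)
      · intro b hb
        exact pow_mem hb n
    exact congrArg Additive.ofMul (QuotientGroup.eq.2 (h2 h3)))

/-- The bracket `[σ, τ] = s⁻¹ t⁻¹ s t ∈ 𝔤_2 = G^(2) / G^(3)`, for arbitrary lifts `s`, `t` of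
`σ, τ ∈ 𝔤_1`. -/
def bracket (σ τ : Gr n G 1) : Gr n G 2 :=
  Quotient.liftOn₂ σ.toMul τ.toMul
    (fun s t => Gr.mk n 2 ((s : G)⁻¹ * (t : G)⁻¹ * s * t) (by
      have := commutator_mem_series n (i := 0) (s : G)⁻¹ (Subgroup.mem_top (t : G)⁻¹)
      simpa [commutatorElement_def] using this))
    (by
      rintro ⟨s, hs⟩ ⟨t, ht⟩ ⟨s', hs'⟩ ⟨t', ht'⟩ h1 h2
      replace h1 : s⁻¹ * s' ∈ series n G 2 :=
        (QuotientGroup.leftRel_apply (s := (series n G 2).subgroupOf (series n G 1))).1 h1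
      replace h2 : t⁻¹ * t' ∈ series n G 2 :=
        (QuotientGroup.leftRel_apply (s := (series n G 2).subgroupOf (series n G 1))).1 h2
      refine congrArg Additive.ofMul (QuotientGroup.eq.2 ?_)
      change (s⁻¹ * t⁻¹ * s * t)⁻¹ * (s'⁻¹ * t'⁻¹ * s' * t') ∈ series n G 3
      have hcomm : ∀ (x b : G), b ∈ series n G 2 → Commute (x : G ⧸ series n G 3) b := by
        intro x b hb
        have := commutator_mem_series n x (i := 1) hb
        rw [← commutatorElement_eq_one_iff_commute]
        exact (QuotientGroup.eq_one_iff _).2 this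
      obtain ⟨a, rfl⟩ : ∃ a, s' = s * a := ⟨s⁻¹ * s', by group⟩
      obtain ⟨b, rfl⟩ : ∃ b, t' = t * b := ⟨t⁻¹ * t', by group⟩
      rw [inv_mul_cancel_left] at h1 h2
      rw [← QuotientGroup.eq]
      have ha := fun x => (hcomm x a h1).eq
      have hb := fun x => (hcomm x b h2).eq
      have e1 := ha s
      have e2 := hb t
      have e3 := ha t⁻¹
      have e4 := hb (s * a)
      simp only [QuotientGroup.mk_mul, QuotientGroup.mk_inv] at e1 e2 e3 e4 ⊢
      generalize (s : G ⧸ series n G 3) = S at *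
      generalize (t : G ⧸ series n G 3) = T at *
      generalize (a : G ⧸ series n G 3) = A at *
      generalize (b : G ⧸ series n G 3) = B at *
      calc S⁻¹ * T⁻¹ * S * T = S⁻¹ * A⁻¹ * (A * T⁻¹) * S * T := by group
        _ = S⁻¹ * A⁻¹ * T⁻¹ * (A * S) * T := by rw [← e3]; group
        _ = S⁻¹ * A⁻¹ * T⁻¹ * (B⁻¹ * (B * (S * A))) * T := by rw [← e1]; group
        _ = (A⁻¹ * S⁻¹) * (B⁻¹ * T⁻¹) * ((S * A) * B) * T := by
          have e5 : S⁻¹ * A⁻¹ = A⁻¹ * S⁻¹ := by rw [← mul_inv_rev, ← mul_inv_rev, e1]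
          have e6 : T⁻¹ * B⁻¹ = B⁻¹ * T⁻¹ := by rw [← mul_inv_rev, ← mul_inv_rev, e2]
          rw [e4, e5, ← e6]; group
        _ = (S * A)⁻¹ * (T * B)⁻¹ * (S * A) * (T * B) := by
          have e7 : (A⁻¹ * S⁻¹) = (S * A)⁻¹ := (mul_inv_rev S A).symm
          have e8 : (B⁻¹ * T⁻¹) = (T * B)⁻¹ := (mul_inv_rev T B).symm
          rw [e7, e8]
          simp only [mul_assoc]
          rw [e2])

variable (G)

/-- `𝔎(G) = H¹(𝔤_1(G), ℤ/n)`: the continuous homomorphisms `𝔤_1(G) → ℤ/n`. The value `σ(x)` of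
`σ ∈ 𝔤_1` at `x ∈ 𝔎`, under the duality pairing, is `x σ`. -/
abbrev Kfr : Type _ := Gr n G 1 →ₜ+ ZMod n

variable {G}

/-- The element of `𝔎(G)` given by a continuous homomorphism `G → ℤ/n`. -/
def Kfr.ofHom (f : G →ₜ* Multiplicative (ZMod n)) : Kfr n G :=
  { MonoidHom.toAdditiveLeft (QuotientGroup.lift ((series n G 2).subgroupOf (series n G 1))
      ((f : G →* Multiplicative (ZMod n)).comp (series n G 1).subtype) (by
        rintro ⟨s, hs⟩ h
        have hcl : IsClosed ((f : G →* Multiplicative (ZMod n)).ker : Set G) :=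
          IsClosed.preimage f.continuous_toFun (isClosed_discrete {1})
        refine series_le n (i := 0) hcl ?_ ?_ h
        · intro a b _
          simp [MonoidHom.mem_ker, commutatorElement_def]
        · intro b _
          have h0 : n • (f b).toAdd = 0 := by simp
          change f (b ^ n) = 1
          rw [map_pow]
          exact congrArg Multiplicative.ofAdd h0)) with
    continuous_toFun := by
      exact continuous_quot_lift _ (f.continuous_toFun.comp continuous_subtype_val) }

end Series

/-! ### Convergence to zero -/

/-- A (possibly infinite) collection of elements converges to `0` if every open normal subgroup
contains all but finitely many of them. -/
def ConvergesToZero {ι A : Type*} [AddGroup A] [TopologicalSpace A] (s : ι → A) : Prop :=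
  ∀ N : OpenNormalAddSubgroup A, {i | s i ∉ N}.Finite

/-! ### The Heisenberg group -/

/-- The Heisenberg group over `ℤ/n`; the element `h(a, b; c)` is the upper triangular matrix
`!![1, a, c; 0, 1, b; 0, 0, 1]`, see `Heis.toMatrix`. -/
@[ext]
structure Heis (n : ℕ) where
  a : ZMod n
  b : ZMod n
  c : ZMod n

namespace Heis

variable {n : ℕ}

instance : Group (Heis n) where
  mul g h := ⟨g.a + h.a, g.b + h.b, g.c + h.c + g.a * h.b⟩
  one := ⟨0, 0, 0⟩
  inv g := ⟨-g.a, -g.b, -g.c + g.a * g.b⟩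
  mul_assoc g h k := by
    ext
    · exact add_assoc _ _ _
    · exact add_assoc _ _ _
    · change (g.c + h.c + g.a * h.b) + k.c + (g.a + h.a) * k.b =
        g.c + (h.c + k.c + h.a * k.b) + g.a * (h.b + k.b)
      ring
  one_mul g := by
    ext
    · exact zero_add _
    · exact zero_add _
    · change 0 + g.c + 0 * g.b = g.c
      ring
  mul_one g := by
    ext
    · exact add_zero _
    · exact add_zero _
    · change g.c + 0 + g.a * 0 = g.c
      ring
  inv_mul_cancel g := by
    ext
    · exact neg_add_cancel _
    · exact neg_add_cancel _
    · change -g.c + g.a * g.b + g.c + -g.a * g.b = 0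
      ring

/-- The finite group `Heis n` carries the discrete topology. -/
instance : TopologicalSpace (Heis n) := ⊥

instance : DiscreteTopology (Heis n) := ⟨rfl⟩

/-- The matrix of an element of the Heisenberg group. -/
def toMatrix (g : Heis n) : Matrix (Fin 3) (Fin 3) (ZMod n) :=
  !![1, g.a, g.c; 0, 1, g.b; 0, 0, 1]

theorem toMatrix_mul (g h : Heis n) : (g * h).toMatrix = g.toMatrix * h.toMatrix := by
  change !![1, g.a + h.a, g.c + h.c + g.a * h.b; 0, 1, g.b + h.b; 0, 0, 1] = _
  ext i j
  fin_cases i <;> fin_cases j <;> simp [toMatrix, Matrix.mul_apply, Fin.sum_univ_three] <;> ring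

theorem toMatrix_injective : Function.Injective (toMatrix (n := n)) := by
  intro g h e
  have e' := fun i j => congrFun (congrFun e i) j
  exact Heis.ext (by simpa [toMatrix] using e' 0 1) (by simpa [toMatrix] using e' 1 2)
    (by simpa [toMatrix] using e' 0 2)

theorem range_toMatrix : Set.range (toMatrix (n := n)) =
    {M | (∀ i, M i i = 1) ∧ ∀ i j, j < i → M i j = 0} := by
  ext M
  constructor
  · rintro ⟨g, rfl⟩
    refine ⟨fun i => ?_, fun i j h => ?_⟩
    · fin_cases i <;> simp [toMatrix]
    · fin_cases i <;> fin_cases j <;> simp [toMatrix] at h ⊢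
  · rintro ⟨h1, h0⟩
    refine ⟨⟨M 0 1, M 1 2, M 0 2⟩, ?_⟩
    ext i j
    fin_cases i <;> fin_cases j <;> simp [toMatrix, h1, h0]

variable (n) in
/-- `e₁ ∈ 𝔎(Heis n)`: the homomorphism induced by `h(a, b; c) ↦ a`. -/
def e₁ : Kfr n (Heis n) :=
  Kfr.ofHom n
    { toFun := fun g => Multiplicative.ofAdd g.a
      map_one' := rfl
      map_mul' := fun _ _ => rfl
      continuous_toFun := continuous_of_discreteTopology }

variable (n) in
/-- `e₂ ∈ 𝔎(Heis n)`: the homomorphism induced by `h(a, b; c) ↦ b`. -/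
def e₂ : Kfr n (Heis n) :=
  Kfr.ofHom n
    { toFun := fun g => Multiplicative.ofAdd g.b
      map_one' := rfl
      map_mul' := fun _ _ => rfl
      continuous_toFun := continuous_of_discreteTopology }

end Heis

/-! ### The embedding problem -/

section Embedding

/-- `f : G → H'` is a solution of the embedding problem `(p : H' → H ; q : G → H)`. -/
def IsSolution {G H' H : Type*} [Group G] [TopologicalSpace G] [Group H'] [TopologicalSpace H']
    (p : H' → H) (q : G → H) (f : G →ₜ* H') : Prop :=
  ∀ g, p (f g) = q g

variable (n : ℕ) (G : Type*) [Group G] [TopologicalSpace G] [IsTopologicalGroup G]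

/-- The quotient map `G → G / G^(3)` as a continuous homomorphism. -/
def toQuot3 : G →ₜ* G ⧸ series n G 3 :=
  { QuotientGroup.mk' (series n G 3) with
    continuous_toFun := QuotientGroup.continuous_mk }

variable {n G}

/-- `φ : G / G^(3) → Heis n` solves the embedding problem
`(Heis n → 𝔤_1(Heis n) → (ℤ/n)² ; G / G^(3) → 𝔤_1(G) → (ℤ/n)²)`, in which the second maps
are `(e₁, e₂)` and `(x, y)`. -/
def SolvesHeis (x y : Kfr n G) (φ : G ⧸ series n G 3 →ₜ* Heis n) : Prop :=
  IsSolution (fun h : Heis n => (Heis.e₁ n (toGr1 n _ h), Heis.e₂ n (toGr1 n _ h)))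
    (fun g : G ⧸ series n G 3 => (x (quotToGr1 n G g), y (quotToGr1 n G g))) φ

/-- The homomorphism `φ₁ : 𝔤_1(G) → 𝔤_1(H)` induced by `φ : G / G^(3) → H`, that is, induced by
the composite `G → G / G^(3) → H`. -/
def phi₁ {H : Type*} [Group H] [TopologicalSpace H] [IsTopologicalGroup H]
    (φ : G ⧸ series n G 3 →ₜ* H) : Gr n G 1 →+ Gr n H 1 :=
  Gr.map n (φ.comp (toQuot3 n G)) 1

end Embedding

end ModCentral

/-! In the Heisenberg group `G^(2)` lies in the subgroup of the `h(0, 0; c)`, which is central and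
killed by `n`, so `G^(3)` is trivial. Hence the coordinate `c` embeds `𝔤_2` additively in `ℤ/n`
(`gr2Coord_injective`), and there the bracket becomes the determinant `a b' - b a'`
(`gr2Coord_bracket`). That `φ` solves the embedding problem means that its coordinates `a` and `b`
are given by `x` and `y`. So the image of `[φ₁ σ, φ₁ τ]` is exactly `σ(x) τ(y) - σ(y) τ(x)`
(`gr2Coord_bracket_phi₁`). Both sums have only finitely many nonzero terms, since `x` and `y` have
open kernels; an injective additive map then carries the vanishing of one sum to that of the other.
-/

namespace ModCentral

namespace Heis

variable {n : ℕ}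

theorem mul_a (g h : Heis n) : (g * h).a = g.a + h.a := rfl
theorem mul_b (g h : Heis n) : (g * h).b = g.b + h.b := rfl
theorem mul_c (g h : Heis n) : (g * h).c = g.c + h.c + g.a * h.b := rfl
theorem inv_a (g : Heis n) : g⁻¹.a = -g.a := rfl
theorem inv_b (g : Heis n) : g⁻¹.b = -g.b := rfl
theorem inv_c (g : Heis n) : g⁻¹.c = -g.c + g.a * g.b := rfl

/-- The projection `h(a, b; c) ↦ (a, b)`. -/
def proj (n : ℕ) : Heis n →* Multiplicative (ZMod n × ZMod n) where
  toFun g := Multiplicative.ofAdd (g.a, g.b)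
  map_one' := rfl
  map_mul' _ _ := rfl

theorem mem_ker_proj {g : Heis n} : g ∈ (proj n).ker ↔ g.a = 0 ∧ g.b = 0 :=
  Multiplicative.ofAdd.injective.eq_iff' (b := ((0, 0) : ZMod n × ZMod n)) rfl |>.trans Prod.mk_inj

/-- The target of `proj` is abelian and killed by `n`, so commutators and `n`-th powers die there.
-/
theorem series_two_le : series n (Heis n) 2 ≤ (proj n).ker := by
  refine series_le n (i := 0) (isClosed_discrete _) (fun a b _ => ?_) (fun b _ => ?_)
  · simp [MonoidHom.mem_ker, commutatorElement_def]
  · rw [MonoidHom.mem_ker, map_pow]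
    refine Multiplicative.toAdd.injective ?_
    ext <;> simp

/-- The coordinate `c`, a homomorphism on the subgroup of the `h(0, 0; c)`. -/
def centralCoord (n : ℕ) : (proj n).ker →* Multiplicative (ZMod n) where
  toFun g := Multiplicative.ofAdd g.1.c
  map_one' := rfl
  map_mul' g h := by
    refine congrArg Multiplicative.ofAdd ?_
    change g.1.c + h.1.c + g.1.a * h.1.b = g.1.c + h.1.c
    -- The cross term of the multiplication vanishes because `g.a = 0`.
    rw [(mem_ker_proj.1 g.2).1, zero_mul, add_zero]

theorem eq_one_of_mem_ker {g : Heis n} (hg : g ∈ (proj n).ker) (hc : g.c = 0) : g = 1 :=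
  Heis.ext (mem_ker_proj.1 hg).1 (mem_ker_proj.1 hg).2 hc

/-- Elements with `a = b = 0` are central, which kills the commutators; `c` is additive on them with
values in `ℤ/n`, which kills the `n`-th powers. -/
theorem series_three_eq_bot : series n (Heis n) 3 = ⊥ := by
  refine le_bot_iff.1 (series_le n (i := 1) (isClosed_discrete _) (fun a b hb => ?_)
    (fun b hb => ?_))
  · obtain ⟨h1, h2⟩ := mem_ker_proj.1 (series_two_le hb)
    rw [Subgroup.mem_bot]
    ext
    · change a.a + b.a + -a.a + -b.a = 0
      ring
    · change a.b + b.b + -a.b + -b.b = 0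
      ring
    · simp only [commutatorElement_def, mul_c, mul_a, inv_a, inv_b, inv_c, h1, h2]
      change _ = (0 : ZMod n)
      ring
  · have h := series_two_le hb
    rw [Subgroup.mem_bot]
    refine eq_one_of_mem_ker (pow_mem h n) ?_
    have : centralCoord n (⟨b, h⟩ ^ n) = 1 := by
      rw [map_pow]
      exact Multiplicative.toAdd.injective (by simp)
    exact this

/-- The homomorphism `𝔤_2(Heis n) → ℤ/n` induced by `h(0, 0; c) ↦ c`. -/
def gr2Coord (n : ℕ) : Gr n (Heis n) 2 →+ ZMod n :=
  MonoidHom.toAdditiveLeft <| QuotientGroup.lift _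
    ((centralCoord n).comp (Subgroup.inclusion series_two_le)) (by
      rintro ⟨s, hs⟩ h
      have h1 : s ∈ series n (Heis n) 3 := h
      rw [series_three_eq_bot, Subgroup.mem_bot] at h1
      subst h1
      rfl)

theorem gr2Coord_mk {s : Heis n} (hs : s ∈ series n (Heis n) 2) :
    gr2Coord n (Gr.mk n 2 s hs) = s.c := rfl

/-- A representative in `G^(2)` already has `a = b = 0`, so `c` determines it. -/
theorem gr2Coord_injective : Function.Injective (gr2Coord n) := by
  refine (injective_iff_map_eq_zero _).2 fun g hg => ?_
  obtain ⟨⟨s, hs⟩, rfl⟩ := QuotientGroup.mk_surjective g.toMul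
  obtain rfl := eq_one_of_mem_ker (series_two_le hs) hg
  rfl

theorem gr2Coord_bracket (s t : Heis n) :
    gr2Coord n (bracket n (toGr1 n _ s) (toGr1 n _ t)) = s.a * t.b - s.b * t.a := by
  change (s⁻¹ * t⁻¹ * s * t).c = _
  simp only [mul_c, mul_a, inv_a, inv_b, inv_c]
  ring

end Heis

theorem gr2Coord_bracket_phi₁ {n : ℕ} {G : Type*} [Group G] [TopologicalSpace G]
    [IsTopologicalGroup G] {x y : Kfr n G} {φ : G ⧸ series n G 3 →ₜ* Heis n}
    (hφ : SolvesHeis x y φ) (σ τ : Gr n G 1) :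
    Heis.gr2Coord n (bracket n (phi₁ φ σ) (phi₁ φ τ)) = x σ * y τ - y σ * x τ := by
  obtain ⟨⟨s, hs⟩, rfl⟩ := QuotientGroup.mk_surjective σ.toMul
  obtain ⟨⟨t, ht⟩, rfl⟩ := QuotientGroup.mk_surjective τ.toMul
  -- The images under `φ` of lifts of `σ` and `τ` are lifts of `φ₁ σ` and `φ₁ τ`.
  refine (Heis.gr2Coord_bracket (φ (s : G ⧸ series n G 3)) (φ (t : G ⧸ series n G 3))).trans ?_
  have h1 := Prod.mk_inj.1 (hφ s)
  have h2 := Prod.mk_inj.1 (hφ t)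
  exact congrArg₂ _ (congrArg₂ _ h1.1 h2.2) (congrArg₂ _ h1.2 h2.1)

/-- The kernel of a continuous homomorphism to a discrete group is open, so it contains all but
finitely many members of the family. -/
theorem ConvergesToZero.finite_support_comp {ι A B : Type*} [AddGroup A] [TopologicalSpace A]
    [AddGroup B] [TopologicalSpace B] [DiscreteTopology B] {s : ι → A}
    (hs : ConvergesToZero s) (f : A →ₜ+ B) : (Function.support fun i => f (s i)).Finite :=
  hs { (f : A →+ B).ker with
    isOpen' := (isOpen_discrete ({0} : Set B)).preimage f.continuous_toFun
    isNormal' := inferInstanceAs (f : A →+ B).ker.Normal }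

end ModCentral

/-- With finite support both `tsum`s are finite sums whatever the topologies, so `f` need not be
continuous. -/
theorem tsum_eq_zero_iff_of_injective {ι A B : Type*} [AddCommMonoid A] [TopologicalSpace A]
    [AddCommMonoid B] [TopologicalSpace B] (f : A →+ B) (hf : Function.Injective f)
    {u : ι → A} (hu : (Function.support u).Finite) :
    ∑' i, u i = 0 ↔ ∑' i, f (u i) = 0 := by
  have h (i : ι) (hi : i ∉ hu.toFinset) : u i = 0 := by simpa using hi
  rw [tsum_eq_sum h, tsum_eq_sum (s := hu.toFinset) fun i hi => by rw [h i hi, map_zero],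
    ← map_sum, map_eq_zero_iff f hf]

theorem proposition3 (n : ℕ) [NeZero n]
    (G : Type*) [Group G] [TopologicalSpace G] [IsTopologicalGroup G]
    [CompactSpace G] [T2Space G] [TotallyDisconnectedSpace G]
    {I : Type*} (hG : Nonempty (ModCentral.Gr n G 1 ≃ₜ+ (I → ZMod n)))
    (x y : ModCentral.Kfr n G)
    (φ : G ⧸ ModCentral.series n G 3 →ₜ* ModCentral.Heis n)
    (hφ : ModCentral.SolvesHeis x y φ)
    {ι : Type*} (σ τ : ι → ModCentral.Gr n G 1)
    (hconv : ModCentral.ConvergesToZero (Sum.elim σ τ)) :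
    Summable (fun i => ModCentral.bracket n (ModCentral.phi₁ φ (σ i)) (ModCentral.phi₁ φ (τ i))) ∧
    Summable (fun i => x (σ i) * y (τ i) - y (σ i) * x (τ i)) ∧
    (∑' i, ModCentral.bracket n (ModCentral.phi₁ φ (σ i)) (ModCentral.phi₁ φ (τ i)) = 0 ↔
      ∑' i, (x (σ i) * y (τ i) - y (σ i) * x (τ i)) = 0) := by
  have hx := (hconv.finite_support_comp x).preimage (Sum.inl_injective.injOn)
  have hy := (hconv.finite_support_comp y).preimage (Sum.inl_injective.injOn)
  have hpair : (Function.support fun i => x (σ i) * y (τ i) - y (σ i) * x (τ i)).Finite := by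
    -- Every product in the `i`-th term has a factor `x (σ i)` or `y (σ i)`, so the term vanishes
    -- once both do.
    refine (hx.union hy).subset fun i hi => ?_
    by_contra h
    have h' : x (σ i) = 0 ∧ y (σ i) = 0 := by simpa using h
    exact hi (by simp [h'.1, h'.2])
  have hcoord := fun i => ModCentral.gr2Coord_bracket_phi₁ hφ (σ i) (τ i)
  have hbracket : (Function.support fun i =>
      ModCentral.bracket n (ModCentral.phi₁ φ (σ i)) (ModCentral.phi₁ φ (τ i))).Finite := by
    -- By injectivity of the coordinate, a bracket is zero wherever the scalar term is.
    refine hpair.subset fun i hi h0 => hi (ModCentral.Heis.gr2Coord_injective ?_)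
    rw [hcoord, map_zero]
    exact h0
  refine ⟨summable_of_hasFiniteSupport hbracket, summable_of_hasFiniteSupport hpair, ?_⟩
  rw [tsum_eq_zero_iff_of_injective _ ModCentral.Heis.gr2Coord_injective hbracket]
  simp only [hcoord]
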